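/- Let $\mathbb K$ be $\mathbb R$ or $\mathbb C$. For a Banach space $Z$ over $\mathbb K$ with dual $Z^*$, and $u\in Z$ with $\|u\|=1$, put $$v(Z,u,z)=\sup\{|\phi(z)| : \phi\in Z^*,\ \|\phi\|=1,\ \phi(u)=1\}\quad(z\in Z),\qquad n(Z,u)=\inf\{v(Z,u,z) : z\in Z,\ \|z\|=1\},$$ and let $\mathcal N(Z)=\{n(Z,u) : u\in Z,\ \|u\|=1\}$. For a Banach space $X$, let $\mathcal L(X)$ be the Banach space of bounded linear operators on $X$ with the operator norm, so that $\mathcal N(\mathcal L(X))$ is the set of numerical indices $n(\mathcal L(X),G)$ with respect to all norm-one operators $G\in\mathcal L(X)$. Theorem. In both the real and the complex case, there is a Banach space $X$ over $\mathbb K$ such that $$\mathcal N(\mathcal L(X))=[0,1].$$ Moreover, $X$ can be taken to be the $c_0$-sum $\bigl[\bigoplus_{\gamma\in[0,1]}Y_\gamma\bigr]_{c_0}$ of a family of Banach spaces $Y_\gamma$ over $\mathbb K$ in such a way that for every $\xi\in[0,1]$ there is a diagonal operator $G^\xi\in\mathcal L(X)$, $G^\xi\bigl((x_\gamma)_\gamma\bigr)=(G^\xi_\gamma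 x_\gamma)_\gamma$ with norm-one operators $G^\xi_\gamma\in\mathcal L(Y_\gamma)$, such that $\|G^\xi\|=1$ and $n(\mathcal L(X),G^\xi)=\xi$. -/

import Mathlib

open scoped ENNReal Topology

universe u

noncomputable section

section AbstractNumericalIndex

variable (𝕜 : Type*) [RCLike 𝕜] {Z : Type*} [NormedAddCommGroup Z] [NormedSpace 𝕜 Z]

/-- The face of the dual unit ball generated by `u`: norm-one functionals taking the value `1`
at `u`. -/
def dualFace (u : Z) : Set (StrongDual 𝕜 Z) :=
  {φ | ‖φ‖ = 1 ∧ φ u = 1}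

/-- The (abstract) numerical range `V(Z, u, z)`. -/
def numericalRange (u z : Z) : Set 𝕜 :=
  (fun φ : StrongDual 𝕜 Z => φ z) '' dualFace 𝕜 u

/-- The numerical radius `v(Z, u, z)`. It is meant for `‖u‖ = 1`; then the set under the supremum
is nonempty and bounded by `‖z‖`. -/
def numericalRadius (u z : Z) : ℝ :=
  sSup ((fun c : 𝕜 => ‖c‖) '' numericalRange 𝕜 u z)

/-- The numerical index `n(Z, u)` of `Z` with respect to `u`. It is meant for `‖u‖ = 1`; then the
set under the infimum is nonempty and bounded below by `0`. -/
def numericalIndex (u : Z) : ℝ :=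
  sInf (numericalRadius 𝕜 u '' {z : Z | ‖z‖ = 1})

variable (Z) in
/-- The set `𝓝(Z)` of all values `n(Z, u)`, where `u` runs over the unit sphere of `Z`. -/
def numericalIndexValues : Set ℝ :=
  numericalIndex 𝕜 '' {u : Z | ‖u‖ = 1}

end AbstractNumericalIndex

/-- The `c₀`-sum of a family of normed spaces: the families `(x i)` with `‖x i‖ → 0` along the
cofinite filter, as a subspace of the `ℓ∞`-sum (so with the norm `sup ‖x i‖`). -/
def c0Sum (𝕜 : Type*) [RCLike 𝕜] {ι : Type*} (Y : ι → Type*) [∀ i, NormedAddCommGroup (Y i)]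
    [∀ i, NormedSpace 𝕜 (Y i)] : Submodule 𝕜 (lp Y ∞) where
  carrier := {x | Filter.Tendsto (fun i => ‖x i‖) Filter.cofinite (𝓝 0)}
  zero_mem' := by simpa using (tendsto_const_nhds : Filter.Tendsto _ _ (𝓝 (0 : ℝ)))
  add_mem' := by
    intro x y hx hy
    have h := Filter.Tendsto.add hx hy
    rw [add_zero] at h
    exact squeeze_zero (fun i => norm_nonneg _) (fun i => norm_add_le (x i) (y i)) h
  smul_mem' := by
    intro c x hx
    have h := Filter.Tendsto.const_mul ‖c‖ hx
    rw [mul_zero] at h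
    exact squeeze_zero (fun i => norm_nonneg _) (fun i => (norm_smul c (x i)).le) h

end

/-!
Both halves of the theorem come from operators whose coordinates have rank one. Take
`Y γ = W γ × 𝕜` with the maximum norm and, for unit vectors `u γ : W γ`, let `G` be the diagonal
operator on the `c₀`-sum with coordinates `(w, s) ↦ (s • u γ, s)`.

*Lower bound.* If every `u γ` satisfies `c ‖w‖ ≤ sup |ψ w|`, with `ψ` running over the face of
`u γ`, then `c ≤ n(L(X), G)`. Indeed, an operator `T` of norm one almost attains its norm at a point
`x` of the unit ball and a coordinate `γ`. Replacing the scalar coordinate `s` of `x γ` by any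
other scalar in the disc does not leave the unit ball, and `T` is affine in that scalar, so `s` may
be taken unimodular. Then `G` maps `x` to a unimodular multiple of `(u γ, 1)` at `γ`, and
functionals `S ↦ s⁻¹ ψ (S x γ)` lie in the face of `G`
(`le_numericalIndex_diagonal_rankOneExtension`).

*Upper bound.* If `w : W γ` is a unit vector with `‖u γ + λ w‖ ≤ 1 + c` for all unimodular `λ`, the
operator `T` sending `x` to `(s • w, 0)` in the coordinate `γ` satisfies `‖G + λ T‖ ≤ 1 + c`, and
this forces `|φ T| ≤ c` on the face of `G` (`numericalIndex_diagonal_rankOneExtension_le`).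

It remains to find `W γ` containing a unit vector of index `γ` and a unit vector of index `1`. On
`𝕜 × 𝕜 × 𝕜` take the norm `max (|a| + γ |b|) |b| + |c|`: the first basis vector has index `γ`,
witnessed by the second one, and the third has index `1`. Then `G^ξ` uses the vector of index `ξ`
in the coordinate `ξ`, and vectors of index `1` elsewhere.
-/

/-! ### Scalars -/

section Scalars

variable {𝕜 : Type*} [RCLike 𝕜]

theorem exists_norm_eq_one_and_norm_eq_mul (x : 𝕜) : ∃ c : 𝕜, ‖c‖ = 1 ∧ x = c * (‖x‖ : 𝕜) := by
  obtain ⟨c, hc, h⟩ := RCLike.exists_norm_eq_mul_self x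
  have hc0 : c ≠ 0 := norm_ne_zero_iff.1 (by rw [hc]; exact one_ne_zero)
  exact ⟨c⁻¹, by rw [norm_inv, hc, inv_one], by rw [h, inv_mul_cancel_left₀ hc0]⟩

/-- A vector-valued affine function of a scalar in the unit disc is at least as large somewhere on
the unit circle. -/
theorem exists_norm_eq_one_and_norm_add_smul_le {E : Type*} [NormedAddCommGroup E]
    [NormedSpace 𝕜 E] (x y : E) {s : 𝕜} (hs : ‖s‖ ≤ 1) :
    ∃ t : 𝕜, ‖t‖ = 1 ∧ ‖x + s • y‖ ≤ ‖x + t • y‖ := by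
  obtain ⟨c, hc, h⟩ := exists_norm_eq_one_and_norm_eq_mul s
  -- `s` lies on the segment joining the antipodal points `c` and `-c`.
  by_contra! H
  have h1 := H c hc
  have h2 := H (-c) (by rwa [norm_neg])
  have hp : 0 ≤ (1 + ‖s‖) / 2 := by positivity
  have hq : 0 ≤ (1 - ‖s‖) / 2 := by linarith
  have key : x + s • y = (((1 + ‖s‖) / 2 : ℝ) : 𝕜) • (x + c • y) +
      (((1 - ‖s‖) / 2 : ℝ) : 𝕜) • (x + (-c) • y) := by
    rw [h, norm_mul, hc]
    push_cast
    rw [RCLike.norm_ofReal, abs_norm]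
    module
  have := calc
    ‖x + s • y‖ ≤ (1 + ‖s‖) / 2 * ‖x + c • y‖ + (1 - ‖s‖) / 2 * ‖x + (-c) • y‖ := by
      rw [key]
      refine (norm_add_le _ _).trans_eq ?_
      rw [norm_smul, norm_smul, RCLike.norm_ofReal, RCLike.norm_ofReal, abs_of_nonneg hp,
        abs_of_nonneg hq]
    _ < ‖x + s • y‖ := by nlinarith [norm_nonneg s]
  exact this.false

end Scalars

/-! ### Bounds for the numerical index -/

section NumericalIndex

variable {𝕜 : Type*} [RCLike 𝕜] {Z : Type*} [NormedAddCommGroup Z] [NormedSpace 𝕜 Z]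

theorem mem_dualFace_of_norm_le {φ : StrongDual 𝕜 Z} {u : Z} (hu : ‖u‖ = 1) (h : ‖φ‖ ≤ 1)
    (hφ : φ u = 1) : φ ∈ dualFace 𝕜 u := by
  refine ⟨h.antisymm ?_, hφ⟩
  simpa [hφ, hu] using φ.le_opNorm u

/-- Rotating a norm-one functional puts it in the face of a unit vector at which it attains its
norm. -/
theorem inv_smul_mem_dualFace {ψ : StrongDual 𝕜 Z} {u : Z} {p : 𝕜} (hu : ‖u‖ = 1) (hp : ‖p‖ = 1)
    (hψ : ‖ψ‖ ≤ 1) (h : ψ u = p) : p⁻¹ • ψ ∈ dualFace 𝕜 u := by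
  have hp0 : p ≠ 0 := norm_ne_zero_iff.1 (by rw [hp]; exact one_ne_zero)
  refine mem_dualFace_of_norm_le hu ?_ ?_
  · rwa [norm_smul, norm_inv, hp, inv_one, one_mul]
  · rw [smul_apply, h, smul_eq_mul, inv_mul_cancel₀ hp0]

theorem norm_inv_smul_apply (ψ : StrongDual 𝕜 Z) {p : 𝕜} (hp : ‖p‖ = 1) (x : Z) :
    ‖(p⁻¹ • ψ) x‖ = ‖ψ x‖ := by
  rw [smul_apply, norm_smul, norm_inv, hp, inv_one, one_mul]

theorem numericalRadius_nonneg (u z : Z) : 0 ≤ numericalRadius 𝕜 u z := by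
  refine Real.sSup_nonneg ?_
  rintro _ ⟨c, -, rfl⟩
  exact norm_nonneg c

theorem norm_apply_le_numericalRadius {φ : StrongDual 𝕜 Z} {u : Z} (hφ : φ ∈ dualFace 𝕜 u)
    (z : Z) : ‖φ z‖ ≤ numericalRadius 𝕜 u z := by
  refine le_csSup ⟨‖z‖, ?_⟩ ⟨_, ⟨φ, hφ, rfl⟩, rfl⟩
  rintro _ ⟨_, ⟨ψ, hψ, rfl⟩, rfl⟩
  simpa [hψ.1] using ψ.le_opNorm z

theorem numericalRadius_le {u z : Z} {c : ℝ} (hc : 0 ≤ c)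
    (h : ∀ φ ∈ dualFace 𝕜 u, ‖φ z‖ ≤ c) : numericalRadius 𝕜 u z ≤ c := by
  refine Real.sSup_le ?_ hc
  rintro _ ⟨_, ⟨φ, hφ, rfl⟩, rfl⟩
  exact h φ hφ

theorem numericalIndex_nonneg (u : Z) : 0 ≤ numericalIndex 𝕜 u := by
  refine Real.sInf_nonneg ?_
  rintro _ ⟨z, -, rfl⟩
  exact numericalRadius_nonneg u z

theorem numericalIndex_le_numericalRadius (u : Z) {z : Z} (hz : ‖z‖ = 1) :
    numericalIndex 𝕜 u ≤ numericalRadius 𝕜 u z := by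
  refine csInf_le ⟨0, ?_⟩ ⟨z, hz, rfl⟩
  rintro _ ⟨y, -, rfl⟩
  exact numericalRadius_nonneg u y

theorem numericalIndex_le_one {u : Z} (hu : ‖u‖ = 1) : numericalIndex 𝕜 u ≤ 1 :=
  (numericalIndex_le_numericalRadius u hu).trans <|
    numericalRadius_le zero_le_one fun φ hφ => by rw [hφ.2, norm_one]

theorem le_numericalIndex {u : Z} (hu : ‖u‖ = 1) {c : ℝ}
    (h : ∀ z : Z, ‖z‖ = 1 → ∀ ε > 0, ∃ φ ∈ dualFace 𝕜 u, c - ε ≤ ‖φ z‖) :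
    c ≤ numericalIndex 𝕜 u := by
  refine le_csInf ⟨_, u, hu, rfl⟩ ?_
  rintro _ ⟨z, hz, rfl⟩
  refine le_of_forall_sub_le fun ε hε => ?_
  obtain ⟨φ, hφ, hle⟩ := h z hz ε hε
  exact hle.trans (norm_apply_le_numericalRadius hφ z)

/-- A unit vector `z` along which the norm grows from `u` with slope at most `c`, in all
unimodular directions, bounds the numerical index by `c`. -/
theorem numericalIndex_le_of_norm_add_smul_le {u z : Z} {c : ℝ} (hc : 0 ≤ c)
    (hz : ‖z‖ = 1) (h : ∀ t : 𝕜, ‖t‖ = 1 → ‖u + t • z‖ ≤ 1 + c) : numericalIndex 𝕜 u ≤ c := by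
  refine (numericalIndex_le_numericalRadius u hz).trans (numericalRadius_le hc fun φ hφ => ?_)
  obtain ⟨t, ht, htz⟩ := RCLike.exists_norm_eq_mul_self (φ z)
  have h1 : φ (u + t • z) = ((1 + ‖φ z‖ : ℝ) : 𝕜) := by
    rw [map_add, map_smul, smul_eq_mul, ← htz, hφ.2]
    push_cast
    rfl
  have h2 : 1 + ‖φ z‖ ≤ ‖u + t • z‖ := by
    have := φ.le_opNorm (u + t • z)
    rwa [h1, hφ.1, one_mul, RCLike.norm_ofReal, abs_of_nonneg (by positivity)] at this
  linarith [h t ht]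

end NumericalIndex

/-! ### Diagonal operators on `c₀`-sums -/

namespace c0Sum

variable {𝕜 : Type*} [RCLike 𝕜] {ι : Type*} {Y : ι → Type*} [∀ i, NormedAddCommGroup (Y i)]
  [∀ i, NormedSpace 𝕜 (Y i)]

theorem norm_apply_le (x : c0Sum 𝕜 Y) (i : ι) : ‖x.1 i‖ ≤ ‖x‖ :=
  lp.norm_apply_le_norm ENNReal.top_ne_zero x.1 i

theorem norm_le {x : c0Sum 𝕜 Y} {C : ℝ} (hC : 0 ≤ C) (h : ∀ i, ‖x.1 i‖ ≤ C) : ‖x‖ ≤ C :=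
  lp.norm_le_of_forall_le hC h

theorem isClosed : IsClosed (c0Sum 𝕜 Y : Set (lp Y ∞)) := by
  refine isClosed_of_closure_subset fun x hx => ?_
  change Filter.Tendsto (fun i => ‖x i‖) Filter.cofinite (𝓝 0)
  rw [Metric.tendsto_nhds]
  intro ε hε
  obtain ⟨y, hy, hxy⟩ := Metric.mem_closure_iff.1 hx (ε / 2) (half_pos hε)
  filter_upwards [(Metric.tendsto_nhds.1 hy) (ε / 2) (half_pos hε)] with i hi
  rw [Real.dist_0_eq_abs, abs_norm] at hi ⊢
  have h1 : ‖x i - y i‖ ≤ ‖x - y‖ := lp.norm_apply_le_norm ENNReal.top_ne_zero (x - y) i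
  rw [dist_eq_norm] at hxy
  linarith [norm_le_norm_add_norm_sub' (x i) (y i)]

theorem completeSpace [∀ i, CompleteSpace (Y i)] : CompleteSpace (c0Sum 𝕜 Y) :=
  isClosed.completeSpace_coe

variable (𝕜) in
/-- The element of the `c₀`-sum with a single nonzero coordinate. -/
noncomputable def single [DecidableEq ι] (i : ι) (y : Y i) : c0Sum 𝕜 Y :=
  ⟨lp.single ∞ i y, by
    refine tendsto_const_nhds.congr' ?_
    filter_upwards [(Set.finite_singleton i).compl_mem_cofinite] with j hj
    rw [lp.single_apply_ne _ _ _ hj, norm_zero]⟩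

theorem single_apply_self [DecidableEq ι] (i : ι) (y : Y i) : (single 𝕜 i y).1 i = y :=
  lp.single_apply_self _ _ _

theorem single_apply_ne [DecidableEq ι] {i j : ι} (h : j ≠ i) (y : Y i) :
    (single 𝕜 i y).1 j = 0 :=
  lp.single_apply_ne _ _ _ h

theorem norm_single [DecidableEq ι] (i : ι) (y : Y i) : ‖single 𝕜 i y‖ = ‖y‖ :=
  lp.norm_single ENNReal.zero_lt_top i y

/-- The evaluation of an element of the `c₀`-sum at a coordinate. -/
noncomputable def proj (i : ι) : c0Sum 𝕜 Y →L[𝕜] Y i :=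
  LinearMap.mkContinuous
    { toFun := fun x => x.1 i
      map_add' := fun _ _ => rfl
      map_smul' := fun _ _ => rfl } 1 fun x => by
    rw [one_mul]
    exact norm_apply_le x i

/-- The diagonal operator with uniformly bounded coordinates `g i`. -/
noncomputable def diagonal (g : ∀ i, Y i →L[𝕜] Y i) {C : ℝ} (hC : 0 ≤ C)
    (hg : ∀ i, ‖g i‖ ≤ C) : c0Sum 𝕜 Y →L[𝕜] c0Sum 𝕜 Y :=
  have hle (x : c0Sum 𝕜 Y) (i : ι) : ‖g i (x.1 i)‖ ≤ C * ‖x.1 i‖ := (g i).le_of_opNorm_le (hg i) _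
  have hmem (x : c0Sum 𝕜 Y) : Memℓp (fun i => g i (x.1 i)) ∞ :=
    memℓp_infty ⟨C * ‖x‖, by
      rintro _ ⟨i, rfl⟩
      exact (hle x i).trans (mul_le_mul_of_nonneg_left (norm_apply_le x i) hC)⟩
  LinearMap.mkContinuous
    { toFun := fun x => ⟨⟨fun i => g i (x.1 i), hmem x⟩, by
        refine squeeze_zero (fun i => norm_nonneg _) (hle x) ?_
        simpa using Filter.Tendsto.const_mul C x.2⟩
      map_add' := fun x y => Subtype.ext <| lp.ext <| funext fun i => map_add (g i) _ _
      map_smul' := fun c x => Subtype.ext <| lp.ext <| funext fun i => map_smul (g i) _ _ }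
    C fun x => norm_le (by positivity) fun i =>
      (hle x i).trans (mul_le_mul_of_nonneg_left (norm_apply_le x i) hC)

theorem diagonal_apply (g : ∀ i, Y i →L[𝕜] Y i) {C : ℝ} (hC : 0 ≤ C) (hg : ∀ i, ‖g i‖ ≤ C)
    (x : c0Sum 𝕜 Y) (i : ι) : (diagonal g hC hg x).1 i = g i (x.1 i) := rfl

theorem norm_diagonal_le (g : ∀ i, Y i →L[𝕜] Y i) {C : ℝ} (hC : 0 ≤ C) (hg : ∀ i, ‖g i‖ ≤ C) :
    ‖diagonal g hC hg‖ ≤ C :=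
  ContinuousLinearMap.opNorm_le_bound _ hC fun x => c0Sum.norm_le (by positivity) fun i =>
    ((g i).le_of_opNorm_le (hg i) _).trans (mul_le_mul_of_nonneg_left (norm_apply_le x i) hC)

theorem norm_le_norm_diagonal (g : ∀ i, Y i →L[𝕜] Y i) {C : ℝ} (hC : 0 ≤ C)
    (hg : ∀ i, ‖g i‖ ≤ C) (i : ι) : ‖g i‖ ≤ ‖diagonal g hC hg‖ := by
  classical
  refine ContinuousLinearMap.opNorm_le_bound _
    (norm_nonneg (diagonal g hC hg)) fun y => ?_
  calc ‖g i y‖ = ‖(diagonal g hC hg (single 𝕜 i y)).1 i‖ := by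
        rw [diagonal_apply, single_apply_self]
    _ ≤ ‖diagonal g hC hg (single 𝕜 i y)‖ := norm_apply_le _ i
    _ ≤ ‖diagonal g hC hg‖ * ‖y‖ := by
        simpa only [norm_single] using (diagonal g hC hg).le_opNorm (single 𝕜 i y)

end c0Sum

/-! ### Operators with rank-one coordinates -/

section RankOneExtension

variable {𝕜 : Type*} [RCLike 𝕜]

section

variable {W : Type*} [NormedAddCommGroup W] [NormedSpace 𝕜 W]

/-- The rank-one operator `(w, s) ↦ (s • u, s)` on `W × 𝕜`. -/
noncomputable def rankOneExtension (u : W) : W × 𝕜 →L[𝕜] W × 𝕜 :=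
  (ContinuousLinearMap.snd 𝕜 W 𝕜).smulRight (u, 1)

theorem rankOneExtension_apply (u : W) (y : W × 𝕜) :
    rankOneExtension u y = y.2 • ((u, 1) : W × 𝕜) := rfl

theorem norm_smulRight_snd_le (y : W × 𝕜) :
    ‖(ContinuousLinearMap.snd 𝕜 W 𝕜).smulRight y‖ ≤ ‖y‖ := by
  rw [ContinuousLinearMap.norm_smulRight_apply]
  exact mul_le_of_le_one_left (norm_nonneg _) (ContinuousLinearMap.norm_snd_le 𝕜 W 𝕜)

theorem norm_rankOneExtension {u : W} (hu : ‖u‖ = 1) :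
    ‖(rankOneExtension u : W × 𝕜 →L[𝕜] W × 𝕜)‖ = 1 := by
  have hw : ‖((u, 1) : W × 𝕜)‖ = 1 := by simp [Prod.norm_mk, hu]
  refine le_antisymm ((norm_smulRight_snd_le _).trans_eq hw) ?_
  have := (rankOneExtension u : W × 𝕜 →L[𝕜] W × 𝕜).le_opNorm (0, 1)
  simpa [rankOneExtension_apply, Prod.norm_mk, hu] using this

/-- Face estimates for `u` in `W` pass to `(u, 1)` in `W × 𝕜`. -/
theorem exists_mem_dualFace_prod {u : W} (hu : ‖u‖ = 1) {c : ℝ} (hc1 : c ≤ 1)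
    (h : ∀ w : W, ∃ ψ ∈ dualFace 𝕜 u, c * ‖w‖ ≤ ‖ψ w‖) (y : W × 𝕜) :
    ∃ ψ ∈ dualFace 𝕜 ((u, 1) : W × 𝕜), c * ‖y‖ ≤ ‖ψ y‖ := by
  have hw : ‖((u, 1) : W × 𝕜)‖ = 1 := by simp [Prod.norm_mk, hu]
  rcases le_total ‖y.1‖ ‖y.2‖ with hy | hy
  · refine ⟨ContinuousLinearMap.snd 𝕜 W 𝕜,
      mem_dualFace_of_norm_le hw (ContinuousLinearMap.norm_snd_le 𝕜 W 𝕜) rfl, ?_⟩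
    rw [Prod.norm_def, max_eq_right hy]
    exact mul_le_of_le_one_left (norm_nonneg _) hc1
  · obtain ⟨ψ, hψ, hle⟩ := h y.1
    refine ⟨ψ.comp (ContinuousLinearMap.fst 𝕜 W 𝕜), mem_dualFace_of_norm_le hw ?_ hψ.2, ?_⟩
    · refine (ContinuousLinearMap.opNorm_comp_le _ _).trans ?_
      rw [hψ.1, one_mul]
      exact ContinuousLinearMap.norm_fst_le 𝕜 W 𝕜
    · rw [Prod.norm_def, max_eq_left hy]
      exact hle

end

variable {ι : Type*} {W : ι → Type*} [∀ i, NormedAddCommGroup (W i)] [∀ i, NormedSpace 𝕜 (W i)]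
  {u : ∀ i, W i}

theorem norm_diagonal_rankOneExtension [Nonempty ι] (hu : ∀ i, ‖u i‖ = 1) :
    ‖c0Sum.diagonal (𝕜 := 𝕜) (fun i => rankOneExtension (u i)) zero_le_one
      fun i => (norm_rankOneExtension (hu i)).le‖ = 1 := by
  refine le_antisymm (c0Sum.norm_diagonal_le _ _ _) ?_
  have i : ι := Classical.arbitrary ι
  have := c0Sum.norm_le_norm_diagonal (𝕜 := 𝕜) (fun i => rankOneExtension (u i)) zero_le_one
    (fun i => (norm_rankOneExtension (hu i)).le) i
  rwa [norm_rankOneExtension (hu i)] at this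

/-- An element of the unit ball of the `c₀`-sum stays there when one of its scalar coordinates is
replaced by a scalar of the unit disc; along the resulting disc an operator is affine, so its
coordinates do not decrease on passing to a suitable unimodular scalar. -/
theorem exists_norm_snd_eq_one_and_norm_apply_le
    (T : c0Sum 𝕜 (fun i => W i × 𝕜) →L[𝕜] c0Sum 𝕜 (fun i => W i × 𝕜))
    {x : c0Sum 𝕜 (fun i => W i × 𝕜)} (hx : ‖x‖ ≤ 1) (i : ι) :
    ∃ x' : c0Sum 𝕜 (fun i => W i × 𝕜),
      ‖x'‖ ≤ 1 ∧ ‖(x'.1 i).2‖ = 1 ∧ ‖(T x).1 i‖ ≤ ‖(T x').1 i‖ := by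
  classical
  have hxi : ‖x.1 i‖ ≤ 1 := (c0Sum.norm_apply_le x i).trans hx
  let s : 𝕜 := (x.1 i).2
  let e : c0Sum 𝕜 (fun i => W i × 𝕜) := c0Sum.single 𝕜 i ((0 : W i), (1 : 𝕜))
  have he : e.1 i = ((0 : W i), (1 : 𝕜)) := c0Sum.single_apply_self _ _
  obtain ⟨t, ht, hle⟩ := exists_norm_eq_one_and_norm_add_smul_le
    ((T x).1 i - s • (T e).1 i) ((T e).1 i) ((norm_snd_le (x.1 i)).trans hxi : ‖s‖ ≤ 1)
  have hx' : (x + (t - s) • e).1 i = ((x.1 i).1, t) := by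
    change x.1 i + (t - s) • e.1 i = _
    rw [he]
    ext <;> simp [s]
  refine ⟨x + (t - s) • e, c0Sum.norm_le zero_le_one fun j => ?_, by rw [hx', ht], ?_⟩
  · by_cases hj : j = i
    · subst hj
      rw [hx', Prod.norm_mk, ht]
      exact max_le ((norm_fst_le _).trans hxi) le_rfl
    · have : (x + (t - s) • e).1 j = x.1 j := by
        change x.1 j + (t - s) • e.1 j = _
        rw [show e.1 j = 0 from c0Sum.single_apply_ne hj _, smul_zero, add_zero]
      rw [this]
      exact (c0Sum.norm_apply_le x j).trans hx
  · have : (T (x + (t - s) • e)).1 i = (T x).1 i - s • (T e).1 i + t • (T e).1 i := by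
      rw [map_add, map_smul]
      change (T x).1 i + (t - s) • (T e).1 i = _
      module
    rwa [this, show (T x).1 i = (T x).1 i - s • (T e).1 i + s • (T e).1 i from
      (sub_add_cancel _ _).symm, add_sub_cancel_right]

theorem le_numericalIndex_diagonal_rankOneExtension [Nonempty ι] (hu : ∀ i, ‖u i‖ = 1) {c : ℝ}
    (hc0 : 0 ≤ c) (hc1 : c ≤ 1)
    (h : ∀ i (w : W i), ∃ ψ ∈ dualFace 𝕜 (u i), c * ‖w‖ ≤ ‖ψ w‖) :
    c ≤ numericalIndex 𝕜 (c0Sum.diagonal (𝕜 := 𝕜) (fun i => rankOneExtension (u i)) zero_le_one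
      fun i => (norm_rankOneExtension (hu i)).le) := by
  have hG := norm_diagonal_rankOneExtension (𝕜 := 𝕜) hu
  refine le_numericalIndex hG fun T hT ε hε => ?_
  obtain ⟨x, hx, i, hi⟩ : ∃ x, ‖x‖ ≤ 1 ∧ ∃ i, 1 - ε ≤ ‖(T x).1 i‖ := by
    obtain ⟨x, hx, hTx⟩ := T.exists_lt_apply_of_lt_opNorm (r := 1 - ε) (by linarith)
    refine ⟨x, hx.le, ?_⟩
    by_contra! H
    have i : ι := Classical.arbitrary ι
    exact hTx.not_ge (c0Sum.norm_le ((norm_nonneg _).trans (H i).le) fun i => (H i).le)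
  obtain ⟨x', hx', ht, hle⟩ := exists_norm_snd_eq_one_and_norm_apply_le T hx i
  obtain ⟨ψ, hψ, hψT⟩ := exists_mem_dualFace_prod (hu i) hc1 (h i) ((T x').1 i)
  let t : 𝕜 := (x'.1 i).2
  have ht' : ‖t‖ = 1 := ht
  have ht0 : t ≠ 0 := norm_ne_zero_iff.1 (by rw [ht']; exact one_ne_zero)
  let φ : StrongDual 𝕜 (c0Sum 𝕜 (fun i => W i × 𝕜) →L[𝕜] c0Sum 𝕜 (fun i => W i × 𝕜)) :=
    t⁻¹ • (ψ.comp (c0Sum.proj i)).comp (ContinuousLinearMap.apply 𝕜 _ x')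
  have hφ (S) : φ S = t⁻¹ * ψ ((S x').1 i) := rfl
  have hφ_norm (S) : ‖φ S‖ = ‖ψ ((S x').1 i)‖ := by
    rw [hφ, norm_mul, norm_inv, ht', inv_one, one_mul]
  refine ⟨φ, mem_dualFace_of_norm_le hG ?_ ?_, ?_⟩
  · refine ContinuousLinearMap.opNorm_le_bound _ zero_le_one fun S => ?_
    rw [hφ_norm, one_mul]
    calc ‖ψ ((S x').1 i)‖ ≤ 1 * ‖(S x').1 i‖ := ψ.le_of_opNorm_le hψ.1.le _
      _ ≤ ‖S x'‖ := by rw [one_mul]; exact c0Sum.norm_apply_le _ i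
      _ ≤ ‖S‖ := S.unit_le_opNorm x' hx'
  · rw [hφ, c0Sum.diagonal_apply, rankOneExtension_apply, map_smul, hψ.2, smul_eq_mul, mul_one]
    exact inv_mul_cancel₀ ht0
  · rw [hφ_norm]
    refine le_trans ?_ hψT
    nlinarith

theorem numericalIndex_diagonal_rankOneExtension_le [Nonempty ι] (hu : ∀ i, ‖u i‖ = 1) {c : ℝ}
    (hc : 0 ≤ c) (i : ι) {w : W i} (hw : ‖w‖ = 1)
    (h : ∀ t : 𝕜, ‖t‖ = 1 → ‖u i + t • w‖ ≤ 1 + c) :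
    numericalIndex 𝕜 (c0Sum.diagonal (𝕜 := 𝕜) (fun i => rankOneExtension (u i)) zero_le_one
      fun i => (norm_rankOneExtension (hu i)).le) ≤ c := by
  classical
  have hwn : ‖(w, (0 : 𝕜))‖ = 1 := by simp [Prod.norm_mk, hw]
  let f : W i × 𝕜 →L[𝕜] W i × 𝕜 := (ContinuousLinearMap.snd 𝕜 (W i) 𝕜).smulRight (w, 0)
  have hf (y : W i × 𝕜) : f y = y.2 • ((w, 0) : W i × 𝕜) := rfl
  have hf1 : ‖f‖ ≤ 1 := (norm_smulRight_snd_le _).trans_eq hwn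
  let g : ∀ j, W j × 𝕜 →L[𝕜] W j × 𝕜 := Pi.single i f
  have hgi : g i = f := Pi.single_eq_same _ _
  have hgj {j} (hj : j ≠ i) : g j = 0 := Pi.single_eq_of_ne hj _
  have hg (j) : ‖g j‖ ≤ 1 := by
    by_cases hj : j = i
    · subst hj
      rwa [hgi]
    · rw [hgj hj, norm_zero]
      exact zero_le_one
  refine numericalIndex_le_of_norm_add_smul_le (z := c0Sum.diagonal g zero_le_one hg) hc ?_ ?_
  · refine le_antisymm (c0Sum.norm_diagonal_le _ _ _) ?_
    refine le_trans ?_ (c0Sum.norm_le_norm_diagonal g zero_le_one hg i)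
    rw [hgi]
    have := f.le_opNorm (0, 1)
    simpa [hf, Prod.norm_mk, hw] using this
  · intro t ht
    refine ContinuousLinearMap.opNorm_le_bound _ (by positivity) fun x => ?_
    refine c0Sum.norm_le (by positivity) fun j => ?_
    change ‖rankOneExtension (u j) (x.1 j) + t • g j (x.1 j)‖ ≤ _
    have hx : ‖(x.1 j).2‖ ≤ ‖x‖ := (norm_snd_le _).trans (c0Sum.norm_apply_le x j)
    by_cases hj : j = i
    · subst hj
      have : rankOneExtension (u j) (x.1 j) + t • g j (x.1 j) =
          (x.1 j).2 • (u j + t • w, (1 : 𝕜)) := by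
        rw [hgi, hf, rankOneExtension_apply]
        ext
        · simp [smul_add, smul_comm t]
        · simp
      rw [this, norm_smul, mul_comm, Prod.norm_mk, norm_one]
      exact mul_le_mul (max_le (h t ht) (by linarith)) hx (norm_nonneg _) (by positivity)
    · rw [hgj hj, zero_apply, smul_zero, add_zero]
      calc ‖rankOneExtension (u j) (x.1 j)‖ ≤ 1 * ‖x.1 j‖ :=
            ContinuousLinearMap.le_of_opNorm_le _ (norm_rankOneExtension (hu j)).le _
        _ ≤ (1 + c) * ‖x‖ :=
            mul_le_mul (by linarith) (c0Sum.norm_apply_le x j) (norm_nonneg _) (by positivity)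

end RankOneExtension

/-! ### A three-dimensional space with unit vectors of index `γ` and `1` -/

/-- The space `𝕜 × 𝕜 × 𝕜` with the norm `max (‖a‖ + γ ‖b‖) ‖b‖ + ‖c‖`, in other words the
`ℓ₁`-sum of a two-dimensional space and `𝕜`. -/
def IndexSpace (𝕜 : Type*) [RCLike 𝕜] (_γ : Set.Icc (0 : ℝ) 1) : Type _ := 𝕜 × 𝕜 × 𝕜

namespace IndexSpace

variable (𝕜 : Type*) [RCLike 𝕜] (γ : Set.Icc (0 : ℝ) 1)

instance : AddCommGroup (IndexSpace 𝕜 γ) := inferInstanceAs (AddCommGroup (𝕜 × 𝕜 × 𝕜))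

instance : Module 𝕜 (IndexSpace 𝕜 γ) := inferInstanceAs (Module 𝕜 (𝕜 × 𝕜 × 𝕜))

instance : Norm (IndexSpace 𝕜 γ) where
  norm x := max (‖x.1‖ + γ * ‖x.2.1‖) ‖x.2.1‖ + ‖x.2.2‖

variable {𝕜 γ}

theorem norm_def (x : IndexSpace 𝕜 γ) :
    ‖x‖ = max (‖x.1‖ + γ * ‖x.2.1‖) ‖x.2.1‖ + ‖x.2.2‖ := rfl

variable (𝕜 γ)

theorem core : NormedSpace.Core 𝕜 (IndexSpace 𝕜 γ) where
  norm_nonneg x := by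
    rw [norm_def]
    positivity
  norm_smul c x := by
    change max (‖c * x.1‖ + γ * ‖c * x.2.1‖) ‖c * x.2.1‖ + ‖c * x.2.2‖ =
      ‖c‖ * (max (‖x.1‖ + γ * ‖x.2.1‖) ‖x.2.1‖ + ‖x.2.2‖)
    rw [norm_mul, norm_mul, norm_mul, mul_add, mul_max_of_nonneg _ _ (norm_nonneg c)]
    ring_nf
  norm_triangle x y := by
    change max (‖x.1 + y.1‖ + γ * ‖x.2.1 + y.2.1‖) ‖x.2.1 + y.2.1‖ + ‖x.2.2 + y.2.2‖ ≤
      max (‖x.1‖ + γ * ‖x.2.1‖) ‖x.2.1‖ + ‖x.2.2‖ +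
        (max (‖y.1‖ + γ * ‖y.2.1‖) ‖y.2.1‖ + ‖y.2.2‖)
    have h1 := norm_add_le x.1 y.1
    have h2 := norm_add_le x.2.1 y.2.1
    have h3 := norm_add_le x.2.2 y.2.2
    have h4 := mul_le_mul_of_nonneg_left h2 γ.2.1
    have hx1 := le_max_left (‖x.1‖ + γ * ‖x.2.1‖) ‖x.2.1‖
    have hx2 := le_max_right (‖x.1‖ + γ * ‖x.2.1‖) ‖x.2.1‖
    have hy1 := le_max_left (‖y.1‖ + γ * ‖y.2.1‖) ‖y.2.1‖
    have hy2 := le_max_right (‖y.1‖ + γ * ‖y.2.1‖) ‖y.2.1‖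
    have : max (‖x.1 + y.1‖ + γ * ‖x.2.1 + y.2.1‖) ‖x.2.1 + y.2.1‖ ≤
        max (‖x.1‖ + γ * ‖x.2.1‖) ‖x.2.1‖ + max (‖y.1‖ + γ * ‖y.2.1‖) ‖y.2.1‖ :=
      max_le (by linarith) (by linarith)
    linarith
  norm_eq_zero_iff x := by
    constructor
    · intro h
      rw [norm_def] at h
      have h1 := le_max_left (‖x.1‖ + γ * ‖x.2.1‖) ‖x.2.1‖
      have h2 := le_max_right (‖x.1‖ + γ * ‖x.2.1‖) ‖x.2.1‖
      have h3 := mul_nonneg γ.2.1 (norm_nonneg x.2.1)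
      have ha : x.1 = 0 := norm_le_zero_iff.1 (by linarith [norm_nonneg x.2.1, norm_nonneg x.2.2])
      have hb : x.2.1 = 0 := norm_le_zero_iff.1 (by linarith [norm_nonneg x.2.2])
      have hc : x.2.2 = 0 := norm_le_zero_iff.1 (by linarith [norm_nonneg x.2.1])
      exact Prod.ext ha (Prod.ext hb hc)
    · rintro rfl
      change max (‖(0 : 𝕜)‖ + γ * ‖(0 : 𝕜)‖) ‖(0 : 𝕜)‖ + ‖(0 : 𝕜)‖ = 0
      simp

instance : NormedAddCommGroup (IndexSpace 𝕜 γ) := .ofCore (core 𝕜 γ)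

instance : NormedSpace 𝕜 (IndexSpace 𝕜 γ) := .ofCore (core 𝕜 γ)

instance : CompleteSpace (IndexSpace 𝕜 γ) :=
  have : FiniteDimensional 𝕜 (IndexSpace 𝕜 γ) :=
    inferInstanceAs (FiniteDimensional 𝕜 (𝕜 × 𝕜 × 𝕜))
  FiniteDimensional.complete 𝕜 _

/-- The vector `(1, 0, 0)`, of index `γ`. -/
def fst : IndexSpace 𝕜 γ := ((1, 0, 0) : 𝕜 × 𝕜 × 𝕜)

/-- The vector `(0, 1, 0)`, in whose direction the index of `fst` is attained. -/
def snd : IndexSpace 𝕜 γ := ((0, 1, 0) : 𝕜 × 𝕜 × 𝕜)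

/-- The vector `(0, 0, 1)`, of index `1`. -/
def thd : IndexSpace 𝕜 γ := ((0, 0, 1) : 𝕜 × 𝕜 × 𝕜)

theorem norm_fst : ‖fst 𝕜 γ‖ = 1 := by
  rw [norm_def]
  simp [fst]

theorem norm_snd : ‖snd 𝕜 γ‖ = 1 := by
  rw [norm_def]
  simp [snd, γ.2.2]

theorem norm_thd : ‖thd 𝕜 γ‖ = 1 := by
  rw [norm_def]
  simp [thd]

variable {𝕜}

theorem norm_fst_add_smul_snd_le {t : 𝕜} (ht : ‖t‖ = 1) : ‖fst 𝕜 γ + t • snd 𝕜 γ‖ ≤ 1 + γ := by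
  change max (‖1 + t * 0‖ + γ * ‖0 + t * 1‖) ‖0 + t * 1‖ + ‖0 + t * 0‖ ≤ _
  simp [ht, γ.2.1]

variable {γ}

/-- The functionals of norm at most `1`, up to convex combinations: the coefficients of `a` and `b`
are dominated either by `(1, γ)` or by `(0, 1)`. -/
theorem exists_strongDual_apply_eq {p q r : 𝕜} (hr : ‖r‖ ≤ 1)
    (hpq : ‖p‖ ≤ 1 ∧ ‖q‖ ≤ γ ∨ p = 0 ∧ ‖q‖ ≤ 1) :
    ∃ ψ : StrongDual 𝕜 (IndexSpace 𝕜 γ), ‖ψ‖ ≤ 1 ∧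
      ∀ x : IndexSpace 𝕜 γ, ψ x = p * x.1 + q * x.2.1 + r * x.2.2 := by
  let l : IndexSpace 𝕜 γ →ₗ[𝕜] 𝕜 :=
    { toFun := fun x => p * x.1 + q * x.2.1 + r * x.2.2
      map_add' := fun x y => by
        change p * (x.1 + y.1) + q * (x.2.1 + y.2.1) + r * (x.2.2 + y.2.2) = _
        ring
      map_smul' := fun c x => by
        change p * (c * x.1) + q * (c * x.2.1) + r * (c * x.2.2) =
          c * (p * x.1 + q * x.2.1 + r * x.2.2)
        ring }
  have hl (x : IndexSpace 𝕜 γ) : ‖l x‖ ≤ 1 * ‖x‖ := by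
    have h1 : ‖l x‖ ≤ ‖p‖ * ‖x.1‖ + ‖q‖ * ‖x.2.1‖ + ‖r‖ * ‖x.2.2‖ := by
      change ‖p * x.1 + q * x.2.1 + r * x.2.2‖ ≤ _
      simpa only [norm_mul] using norm_add₃_le (a := p * x.1) (b := q * x.2.1) (c := r * x.2.2)
    have h2 : ‖r‖ * ‖x.2.2‖ ≤ ‖x.2.2‖ := mul_le_of_le_one_left (norm_nonneg _) hr
    have h3 : ‖p‖ * ‖x.1‖ + ‖q‖ * ‖x.2.1‖ ≤ max (‖x.1‖ + γ * ‖x.2.1‖) ‖x.2.1‖ := by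
      rcases hpq with ⟨hp, hq⟩ | ⟨rfl, hq⟩
      · exact le_max_of_le_left (add_le_add (mul_le_of_le_one_left (norm_nonneg _) hp)
          (mul_le_mul_of_nonneg_right hq (norm_nonneg _)))
      · rw [norm_zero, zero_mul, zero_add]
        exact le_max_of_le_right (mul_le_of_le_one_left (norm_nonneg _) hq)
    rw [one_mul, norm_def]
    linarith
  exact ⟨l.mkContinuous 1 hl, l.mkContinuous_norm_le zero_le_one hl, fun _ => rfl⟩

/-- A functional taking the value `‖a‖ + γ ‖b‖ + ‖c‖` at `(a, b, c)`; a rotation of it lies in the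
face of `fst`, and another one in the face of `thd`. -/
theorem exists_norm_eq_one_and_strongDual_apply_eq (x : IndexSpace 𝕜 γ) :
    ∃ (p r : 𝕜) (ψ : StrongDual 𝕜 (IndexSpace 𝕜 γ)), ‖p‖ = 1 ∧ ‖r‖ = 1 ∧ ‖ψ‖ ≤ 1 ∧
      ψ (fst 𝕜 γ) = p ∧ ψ (thd 𝕜 γ) = r ∧ ‖ψ x‖ = ‖x.1‖ + γ * ‖x.2.1‖ + ‖x.2.2‖ := by
  obtain ⟨p, hp, hpx⟩ := RCLike.exists_norm_eq_mul_self x.1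
  obtain ⟨q, hq, hqx⟩ := RCLike.exists_norm_eq_mul_self x.2.1
  obtain ⟨r, hr, hrx⟩ := RCLike.exists_norm_eq_mul_self x.2.2
  have hγ : ‖((γ : ℝ) : 𝕜) * q‖ = γ := by
    rw [norm_mul, hq, mul_one, RCLike.norm_ofReal, abs_of_nonneg γ.2.1]
  obtain ⟨ψ, hψ, h⟩ := exists_strongDual_apply_eq (γ := γ) (p := p) (q := ((γ : ℝ) : 𝕜) * q)
    hr.le (.inl ⟨hp.le, hγ.le⟩)
  refine ⟨p, r, ψ, hp, hr, hψ, ?_, ?_, ?_⟩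
  · rw [h]
    simp [fst]
  · rw [h]
    simp [thd]
  have h0 : 0 ≤ ‖x.1‖ + γ * ‖x.2.1‖ + ‖x.2.2‖ := by
    have := mul_nonneg γ.2.1 (norm_nonneg x.2.1)
    positivity
  have : ψ x = ((‖x.1‖ + γ * ‖x.2.1‖ + ‖x.2.2‖ : ℝ) : 𝕜) := by
    rw [h, mul_assoc, ← hpx, ← hqx, ← hrx]
    push_cast
    rfl
  rw [this, RCLike.norm_ofReal, abs_of_nonneg h0]

theorem exists_mem_dualFace_fst (x : IndexSpace 𝕜 γ) :
    ∃ ψ ∈ dualFace 𝕜 (fst 𝕜 γ), γ * ‖x‖ ≤ ‖ψ x‖ := by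
  obtain ⟨p, r, ψ, hp, -, hψ, hψp, -, hx⟩ := exists_norm_eq_one_and_strongDual_apply_eq x
  refine ⟨_, inv_smul_mem_dualFace (norm_fst 𝕜 γ) hp hψ hψp, ?_⟩
  rw [norm_inv_smul_apply _ hp, hx, norm_def, mul_add, mul_max_of_nonneg _ _ γ.2.1]
  have h0 := mul_nonneg γ.2.1 (norm_nonneg x.2.1)
  have h1 := mul_le_of_le_one_left (norm_nonneg x.2.2) γ.2.2
  refine add_le_add (max_le (mul_le_of_le_one_left (by positivity) γ.2.2) ?_) h1
  linarith [norm_nonneg x.1]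

theorem exists_mem_dualFace_thd (x : IndexSpace 𝕜 γ) :
    ∃ ψ ∈ dualFace 𝕜 (thd 𝕜 γ), ‖x‖ ≤ ‖ψ x‖ := by
  rcases le_total ‖x.2.1‖ (‖x.1‖ + γ * ‖x.2.1‖) with hx | hx
  · obtain ⟨p, r, ψ, -, hr, hψ, -, hψr, hψx⟩ := exists_norm_eq_one_and_strongDual_apply_eq x
    refine ⟨_, inv_smul_mem_dualFace (norm_thd 𝕜 γ) hr hψ hψr, ?_⟩
    rw [norm_inv_smul_apply _ hr, hψx, norm_def, max_eq_left hx]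
  · obtain ⟨q, hq, hqx⟩ := RCLike.exists_norm_eq_mul_self x.2.1
    obtain ⟨r, hr, hrx⟩ := RCLike.exists_norm_eq_mul_self x.2.2
    obtain ⟨ψ, hψ, h⟩ := exists_strongDual_apply_eq (γ := γ) hr.le (.inr ⟨rfl, hq.le⟩)
    refine ⟨_, inv_smul_mem_dualFace (norm_thd 𝕜 γ) hr hψ (by rw [h]; simp [thd]), ?_⟩
    have : ψ x = ((‖x.2.1‖ + ‖x.2.2‖ : ℝ) : 𝕜) := by
      rw [h, ← hqx, ← hrx]
      push_cast
      ring
    rw [norm_inv_smul_apply _ hr, this, RCLike.norm_ofReal, abs_of_nonneg (by positivity),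
      norm_def, max_eq_right hx]

variable (𝕜) in
open Classical in
/-- The family of unit vectors with index `ξ` in the coordinate `ξ` and index `1` elsewhere. -/
noncomputable def indexFamily (ξ γ : Set.Icc (0 : ℝ) 1) : IndexSpace 𝕜 γ :=
  if γ = ξ then fst 𝕜 γ else thd 𝕜 γ

theorem norm_indexFamily (ξ γ : Set.Icc (0 : ℝ) 1) : ‖indexFamily 𝕜 ξ γ‖ = 1 := by
  unfold indexFamily
  split_ifs
  exacts [norm_fst 𝕜 γ, norm_thd 𝕜 γ]

theorem exists_mem_dualFace_indexFamily (ξ γ : Set.Icc (0 : ℝ) 1) (x : IndexSpace 𝕜 γ) :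
    ∃ ψ ∈ dualFace 𝕜 (indexFamily 𝕜 ξ γ), ξ * ‖x‖ ≤ ‖ψ x‖ := by
  unfold indexFamily
  split_ifs with h
  · subst h
    exact exists_mem_dualFace_fst x
  · obtain ⟨ψ, hψ, hx⟩ := exists_mem_dualFace_thd x
    exact ⟨ψ, hψ, (mul_le_of_le_one_left (norm_nonneg x) ξ.2.2).trans hx⟩

theorem norm_indexFamily_self_add_smul_snd_le (ξ : Set.Icc (0 : ℝ) 1) {t : 𝕜} (ht : ‖t‖ = 1) :
    ‖indexFamily 𝕜 ξ ξ + t • snd 𝕜 ξ‖ ≤ 1 + ξ := by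
  rw [indexFamily, if_pos rfl]
  exact norm_fst_add_smul_snd_le ξ ht

end IndexSpace

/-! ### The numerical indices of operators on the `c₀`-sum -/

open IndexSpace in
theorem theorem6p4 (𝕜 : Type u) [RCLike 𝕜] :
    ∃ (Y : Set.Icc (0 : ℝ) 1 → Type u) (_ : ∀ γ, NormedAddCommGroup (Y γ))
      (_ : ∀ γ, NormedSpace 𝕜 (Y γ)),
      (∀ γ, CompleteSpace (Y γ)) ∧
      CompleteSpace (c0Sum 𝕜 Y) ∧
      numericalIndexValues 𝕜 (c0Sum 𝕜 Y →L[𝕜] c0Sum 𝕜 Y) = Set.Icc (0 : ℝ) 1 ∧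
      ∀ ξ : Set.Icc (0 : ℝ) 1,
        ∃ (G : c0Sum 𝕜 Y →L[𝕜] c0Sum 𝕜 Y) (g : ∀ γ, Y γ →L[𝕜] Y γ),
          (∀ γ, ‖g γ‖ = 1) ∧
          (∀ (x : c0Sum 𝕜 Y) (γ : Set.Icc (0 : ℝ) 1), (G x).1 γ = g γ (x.1 γ)) ∧
          ‖G‖ = 1 ∧
          numericalIndex 𝕜 G = (ξ : ℝ) := by
  have main (ξ : Set.Icc (0 : ℝ) 1) :=
    le_antisymm
      (numericalIndex_diagonal_rankOneExtension_le (𝕜 := 𝕜) (norm_indexFamily ξ) ξ.2.1 ξ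
        (norm_snd 𝕜 ξ) fun _ => norm_indexFamily_self_add_smul_snd_le ξ)
      (le_numericalIndex_diagonal_rankOneExtension (norm_indexFamily ξ) ξ.2.1 ξ.2.2
        (exists_mem_dualFace_indexFamily ξ))
  refine ⟨fun γ => IndexSpace 𝕜 γ × 𝕜, fun γ => inferInstance, fun γ => inferInstance,
    fun γ => inferInstance, c0Sum.completeSpace, ?_, fun ξ => ?_⟩
  · refine Set.Subset.antisymm ?_ fun ξ hξ => ?_
    · rintro _ ⟨G, hG, rfl⟩
      exact ⟨numericalIndex_nonneg G, numericalIndex_le_one hG⟩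
    · exact ⟨_, norm_diagonal_rankOneExtension (norm_indexFamily ⟨ξ, hξ⟩), main ⟨ξ, hξ⟩⟩
  · exact ⟨_, fun γ => rankOneExtension (indexFamily 𝕜 ξ γ),
      fun γ => norm_rankOneExtension (norm_indexFamily ξ γ), fun _ _ => rfl,
      norm_diagonal_rankOneExtension (norm_indexFamily ξ), main ξ⟩
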